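/- Consider the single-input single-output plant $x_{k+1}=Ax_k+Bu_k$, $y_k=Cx_k$ with $A\in\mathbb{R}^{n\times n}$, $B\in\mathbb{R}^{n\times 1}$, $C\in\mathbb{R}^{1\times n}$, where $(A,B)$ is controllable, $(A,C)$ is observable and $A$ has at least one eigenvalue of modulus greater than $1$; let $\lambda_0,\dots,\lambda_{n-1}$ be its eigenvalues, listed with multiplicity. Let $N\ge 1$, and let $s_1,s_2\in\{0,1\}^N$ be periodic vectors: for $i=1,2$, $N_i\ge1$ divides $N$ and $s_i$ consists of $N_i$ consecutive copies of the block $[1\;0\cdots 0]$ of length $N/N_i$. Put $S_{i,k}=s_i(r+1)$ for $k=lN+r$, $0\le r<N$. Let $\theta_{1,k},\theta_{2,k}\in\{0,1\}$ be the loss processes of the two channels (the value $0$ means a loss): the pairs $(\theta_{1,k},\theta_{2,k})$, $k\ge 0$, are independent and identically distributed, and $\alpha_i=\mathrm{Prob}\{\theta_{i,k}=0\}$. The received measurement is $\hat y_k=\theta_{1,k}S_{1,k}y_k$. The controller is observer-based, $$\xi_{k+1}=A\xi_k+Bu_k+L_{k,\theta_{2,k}}\bigl(\theta_{1,k}S_{1,k}C\xi_k-\hat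 y_k\bigr),\qquad \hat u_k=F_{k,\theta_{1,k}}\xi_k,$$ with $\xi_k\in\mathbb{R}^n$ and gains $L_{k,i}$, $F_{k,i}$, $i\in\{0,1\}$, that are $N$-periodic in $k$. At the actuator there is a decoder $$\eta_{k+1}=A_{D,k}\eta_k+B_{D,k}u_k,\qquad \zeta_k=C_{D,k}\eta_k,\qquad u_k=\theta_{2,k}S_{2,k}\hat u_k+(1-\theta_{2,k}S_{2,k})\zeta_k,$$ with $\eta_k\in\mathbb{R}^{d}$ and $N$-periodic matrices, which is internally stable: if $\theta_{2,k}\equiv 0$, then $\eta_k\to 0$ for every $\eta_0$. Suppose that the closed loop with state $z_k=(x_k,\xi_k,\eta_k)$ is stochastically stable, i.e. $E\bigl[\sum_{k=0}^\infty |z_k|^2\bigr]<\infty$ for every (deterministic) initial state $z_0$. Then $$\alpha_1<\frac{1}{\prod_{|\lambda_i|>1}|\lambda_i|^{2N/N_1}}\qquad\text{and}\qquad \alpha_2<\frac{1}{\prod_{|\lambda_i|>1}|\lambda_i|^{2N/N_2}}.$$ -/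

import Mathlib

open MeasureTheory ProbabilityTheory Filter Topology
open scoped Matrix ENNReal

noncomputable section

/-- The single-input single-output plant `x (k+1) = A x k + B u k`, `y k = C x k`. -/
structure Plant (n : ℕ) where
  A : Matrix (Fin n) (Fin n) ℝ
  B : Fin n → ℝ
  C : Fin n → ℝ

namespace Plant

variable {n : ℕ}

/-- The columns `B, A B, …, A ^ (n-1) B` of the controllability matrix span `ℝⁿ`. -/
def Controllable (G : Plant n) : Prop :=
  Submodule.span ℝ (Set.range fun i : Fin n => (G.A ^ (i : ℕ)) *ᵥ G.B) = ⊤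

/-- The rows `C, C A, …, C A ^ (n-1)` of the observability matrix span `ℝⁿ`. -/
def Observable (G : Plant n) : Prop :=
  Submodule.span ℝ (Set.range fun i : Fin n => G.C ᵥ* (G.A ^ (i : ℕ))) = ⊤

/-- The eigenvalues of `A` in `ℂ`, listed with algebraic multiplicity. -/
def eigenvalues (G : Plant n) : Multiset ℂ :=
  (G.A.map (algebraMap ℝ ℂ)).charpoly.roots

/-- `A` has an eigenvalue outside the closed unit disc. -/
def Unstable (G : Plant n) : Prop :=
  ∃ l ∈ G.eigenvalues, 1 < ‖l‖

open Classical in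
/-- The product of `|l| ^ q` over the eigenvalues `l` of `A` with `|l| > 1`, counted with
algebraic multiplicity. -/
def unstableProd (G : Plant n) (q : ℕ) : ℝ :=
  ((G.eigenvalues.filter fun l => 1 < ‖l‖).map fun l => ‖l‖ ^ q).prod

end Plant

/-- `S_k` for a switching pattern `s ∈ {0,1}^N`: at time `k = l N + r` it equals the entry of `s`
with (zero-based) index `r`. -/
def switchAt {N : ℕ} [NeZero N] (s : Fin N → Fin 2) (k : ℕ) : ℝ :=
  ((s (Fin.ofNat N k) : ℕ) : ℝ)

/-- `s` consists of `m` consecutive copies of the block `[1 0 … 0]` of length `N / m`;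
so `m` is its number of ones. -/
def IsPeriodicVector {N : ℕ} (s : Fin N → Fin 2) (m : ℕ) : Prop :=
  0 < m ∧ m ∣ N ∧ ∀ r : Fin N, s r = if (N / m) ∣ (r : ℕ) then 1 else 0

/-- The gains of an observer-based controller with `N`-periodic feedback gains `F k θ₁` (rows) and
`N`-periodic observer gains `L k θ₂` (columns). -/
structure ObserverController (N n : ℕ) where
  F : ℕ → Fin 2 → Fin n → ℝ
  L : ℕ → Fin 2 → Fin n → ℝ
  F_periodic : Function.Periodic F N
  L_periodic : Function.Periodic L N

/-- The `N`-periodic decoder `η (k+1) = AD k (η k) + BD k (u k)`, `ζ k = CD k (η k)`. -/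
structure Decoder (N d : ℕ) where
  AD : ℕ → Matrix (Fin d) (Fin d) ℝ
  BD : ℕ → Fin d → ℝ
  CD : ℕ → Fin d → ℝ
  AD_periodic : Function.Periodic AD N
  BD_periodic : Function.Periodic BD N
  CD_periodic : Function.Periodic CD N

namespace Decoder

variable {N d : ℕ}

/-- The control candidate `ζ k`. -/
def candidate (D : Decoder N d) (k : ℕ) (η : Fin d → ℝ) : ℝ :=
  D.CD k ⬝ᵥ η

/-- The control input `u k = t û + (1 - t) ζ k`, where `t = θ₂ S₂` is the indicator that
`û` was transmitted and arrived. -/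
def output (D : Decoder N d) (k : ℕ) (t : ℝ) (uhat : ℝ) (η : Fin d → ℝ) : ℝ :=
  t * uhat + (1 - t) * D.candidate k η

/-- The state update driven by the control input `u`. -/
def next (D : Decoder N d) (k : ℕ) (η : Fin d → ℝ) (u : ℝ) : Fin d → ℝ :=
  D.AD k *ᵥ η + u • D.BD k

/-- If no message ever arrives (so that the decoder is driven by its own candidate), then every
decoder trajectory tends to zero, whatever the controller sends. -/
def InternallyStable (D : Decoder N d) : Prop :=
  ∀ (uhat : ℕ → ℝ) (η : ℕ → Fin d → ℝ),
    (∀ k, η (k + 1) = D.next k (η k) (D.output k 0 (uhat k) (η k))) →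
      Tendsto η atTop (𝓝 0)

end Decoder

/-- The state of the closed loop: plant state, controller state, decoder state. -/
structure LoopState (n d : ℕ) where
  x : Fin n → ℝ
  ξ : Fin n → ℝ
  η : Fin d → ℝ

/-- The squared Euclidean norm of the closed-loop state. -/
def LoopState.sqNorm {n d : ℕ} (z : LoopState n d) : ℝ :=
  z.x ⬝ᵥ z.x + z.ξ ⬝ᵥ z.ξ + z.η ⬝ᵥ z.η

section ClosedLoop

variable {n d N : ℕ} [NeZero N]

/-- One step of the closed loop at time `k` when the loss variables are `θ₁`, `θ₂`
(`0` means that the message is lost). -/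
def loopStep (G : Plant n) (s₁ s₂ : Fin N → Fin 2) (K : ObserverController N n)
    (D : Decoder N d) (k : ℕ) (θ₁ θ₂ : Fin 2) (z : LoopState n d) : LoopState n d :=
  -- the transmitted measurement, received as `yhat`
  let t₁ : ℝ := ((θ₁ : ℕ) : ℝ) * switchAt s₁ k
  let yhat : ℝ := t₁ * (G.C ⬝ᵥ z.x)
  -- the transmitted control signal and the input that the decoder applies to the plant
  let t₂ : ℝ := ((θ₂ : ℕ) : ℝ) * switchAt s₂ k
  let uhat : ℝ := K.F k θ₁ ⬝ᵥ z.ξ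
  let u : ℝ := D.output k t₂ uhat z.η
  { x := G.A *ᵥ z.x + u • G.B
    ξ := G.A *ᵥ z.ξ + u • G.B + (t₁ * (G.C ⬝ᵥ z.ξ) - yhat) • K.L k θ₂
    η := D.next k z.η u }

/-- The closed-loop trajectory from the initial state `z₀` along a realization of the losses. -/
def loopTrajectory (G : Plant n) (s₁ s₂ : Fin N → Fin 2) (K : ObserverController N n)
    (D : Decoder N d) (θ₁ θ₂ : ℕ → Fin 2) (z₀ : LoopState n d) : ℕ → LoopState n d
  | 0 => z₀
  | k + 1 => loopStep G s₁ s₂ K D k (θ₁ k) (θ₂ k)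
      (loopTrajectory G s₁ s₂ K D θ₁ θ₂ z₀ k)

/-- Stochastic stability of the closed loop: from every initial state, the expectation of
`∑ k, |z k|²` is finite. -/
def LoopStochasticallyStable {Ω : Type*} [MeasurableSpace Ω] (P : Measure Ω)
    (G : Plant n) (s₁ s₂ : Fin N → Fin 2) (K : ObserverController N n) (D : Decoder N d)
    (θ₁ θ₂ : ℕ → Ω → Fin 2) : Prop :=
  ∀ z₀ : LoopState n d,
    ∫⁻ ω, ∑' k, ENNReal.ofReal
      (loopTrajectory G s₁ s₂ K D (fun j => θ₁ j ω) (fun j => θ₂ j ω) z₀ k).sqNorm ∂P < ∞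

end ClosedLoop

/-- The loss processes of the two channels: the pairs `(θ₁ k, θ₂ k)` are independent and identically
distributed in `k`, and `α₁`, `α₂` are the probabilities of a loss in each channel. -/
structure IsLossProcess {Ω : Type*} [MeasurableSpace Ω] (P : Measure Ω)
    (θ₁ θ₂ : ℕ → Ω → Fin 2) (α₁ α₂ : ℝ) : Prop where
  measurable₁ : ∀ k, Measurable (θ₁ k)
  measurable₂ : ∀ k, Measurable (θ₂ k)
  indep : iIndepFun (fun k ω => (θ₁ k ω, θ₂ k ω)) P
  identDistrib : ∀ k, IdentDistrib (fun ω => (θ₁ k ω, θ₂ k ω)) (fun ω => (θ₁ 0 ω, θ₂ 0 ω)) P P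
  loss₁ : ∀ k, P.real {ω | θ₁ k ω = 0} = α₁
  loss₂ : ∀ k, P.real {ω | θ₂ k ω = 0} = α₂

end

/-! Each bound comes from a linear recursion inside the closed loop whose random matrices differ
only by rank-one terms. The observer error `ξ - x` is driven by `A + t₁ L C`, since the input
cancels. Started with `ξ = x`, plant and decoder are driven by a fixed block triangular matrix plus
a rank-one feedback term, present only when a control message arrives. Restrict to the unstable
invariant subspace of `A` (of its transpose for the observer), on which `A` acts as `T` with `|det
T|` the product of the unstable moduli.

The quantity to follow is the determinant of the second moment compressed to this subspace. Without
a message it is multiplied by `|det T|²`. A rank-one correction can lower it, but averaging over the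
losses keeps at least the fraction `α` (`Matrix.PosSemidef.mul_det_le_det_sum_rankOne`). Over a
period of length `q = N / Nᵢ` containing one transmission the factor is at least `α |det T|^(2q)`.
Stability sends the trace to zero, and the determinant with it, so this factor is less than one
(`mul_pow_lt_one_of_tendsto_trace`). The feedback bound uses backward cost iterates, the observer
bound the dual forward covariances. Only the marginal loss probability of one channel enters each
bound, so the two channels may be correlated. -/

noncomputable section

/-! ### Determinants of averaged rank-one perturbations. -/

section RankOne

open scoped ComplexOrder

variable {ι n m : Type*}

/-- Pythagoras for the form `P`: the columns of `U` are `P`-orthogonal to `b`, so the cross terms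
vanish. -/
lemma Matrix.PosSemidef.conjTranspose_add_vecMulVec [Fintype n] {P : Matrix n n ℂ}
    (hP : P.PosSemidef) (U : Matrix n m ℂ) (b : n → ℂ) (hU : Uᴴ *ᵥ (P *ᵥ b) = 0) (h : m → ℂ) :
    (U + Matrix.vecMulVec b h)ᴴ * P * (U + Matrix.vecMulVec b h)
      = Uᴴ * P * U + (star b ⬝ᵥ (P *ᵥ b)) • Matrix.vecMulVec (star h) h := by
  have h1 : (Uᴴ * P) * Matrix.vecMulVec b h = 0 := by
    rw [Matrix.mul_vecMulVec, ← Matrix.mulVec_mulVec, hU, Matrix.zero_vecMulVec]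
  have h2 : (Matrix.vecMulVec b h)ᴴ * P * U = 0 := by
    have := congrArg Matrix.conjTranspose h1
    simpa [Matrix.conjTranspose_mul, hP.isHermitian.eq, Matrix.mul_assoc] using this
  have h3 : (Matrix.vecMulVec b h)ᴴ * P * Matrix.vecMulVec b h
      = (star b ⬝ᵥ (P *ᵥ b)) • Matrix.vecMulVec (star h) h := by
    rw [Matrix.mul_assoc, Matrix.mul_vecMulVec, Matrix.conjTranspose_vecMulVec,
      Matrix.vecMulVec_mul_vecMulVec, Matrix.vecMulVec_smul]
  rw [Matrix.conjTranspose_add, Matrix.add_mul, Matrix.add_mul, Matrix.mul_add, Matrix.mul_add,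
    h1, h2, h3]
  simp

variable [Fintype m]

lemma Matrix.PosSemidef.smul_vecMulVec_self_star {γ : ℂ} (hγ : 0 ≤ γ) (v : m → ℂ) :
    (γ • Matrix.vecMulVec v (star v)).PosSemidef :=
  (Matrix.posSemidef_vecMulVec_self_star v).smul hγ

variable [DecidableEq m]

lemma Matrix.det_add_vecMulVec {X : Matrix m m ℂ} (hX : X.det ≠ 0) (u v : m → ℂ) :
    (X + Matrix.vecMulVec u v).det = X.det * (1 + v ⬝ᵥ (X⁻¹ *ᵥ u)) := by
  have h := Matrix.det_add_replicateCol_mul_replicateRow (ι := Unit) (A := X)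
    (isUnit_iff_ne_zero.mpr hX) u v
  rw [← Matrix.vecMulVec_eq Unit] at h
  rw [h]
  congr 1
  simp [Matrix.det_unique, Matrix.mul_apply, dotProduct, Matrix.mulVec, Finset.mul_sum,
    Finset.sum_mul, mul_assoc]
  rw [Finset.sum_comm]

/-- The determinant is affine along rank-one perturbations. -/
lemma Matrix.det_add_smul_vecMulVec {R : Matrix m m ℂ} (u v : m → ℂ)
    (h : (R + Matrix.vecMulVec u v).det ≠ 0) (t : ℂ) :
    (R + t • Matrix.vecMulVec u v).det
      = t * (R + Matrix.vecMulVec u v).det + (1 - t) * R.det := by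
  -- Expand around the parameter value 1, where the matrix is invertible; `R` itself may be
  -- singular.
  have key : ∀ s : ℂ, (R + s • Matrix.vecMulVec u v).det = (R + Matrix.vecMulVec u v).det *
      (1 + (s - 1) * (v ⬝ᵥ ((R + Matrix.vecMulVec u v)⁻¹ *ᵥ u))) := fun s => by
    have := Matrix.det_add_vecMulVec h ((s - 1) • u) v
    rw [Matrix.mulVec_smul, dotProduct_smul, smul_eq_mul] at this
    rw [← this, Matrix.smul_vecMulVec]
    congr 1
    module
  have h0 := key 0
  rw [zero_smul, add_zero] at h0
  rw [key t, h0]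
  ring

lemma Matrix.PosSemidef.det_le_det_add_smul_vecMulVec {X : Matrix m m ℂ} (hX : X.PosSemidef)
    {γ : ℂ} (hγ : 0 ≤ γ) (v : m → ℂ) :
    X.det ≤ (X + γ • Matrix.vecMulVec v (star v)).det := by
  by_cases h0 : X.det = 0
  · rw [h0]
    exact (hX.add (Matrix.PosSemidef.smul_vecMulVec_self_star hγ v)).det_nonneg
  · have hpos : X.PosDef := hX.posDef_iff_det_ne_zero.mpr h0
    rw [← Matrix.smul_vecMulVec, Matrix.det_add_vecMulVec h0, mul_add, mul_one,
      Matrix.mulVec_smul, dotProduct_smul, smul_eq_mul]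
    exact le_add_of_nonneg_right (mul_nonneg hX.det_nonneg
      (mul_nonneg hγ (hX.inv.dotProduct_mulVec_nonneg v)))

lemma Matrix.PosSemidef.det_le_det_add_sum {X : Matrix m m ℂ} (hX : X.PosSemidef)
    {γ : ι → ℂ} (hγ : ∀ i, 0 ≤ γ i) (v : ι → m → ℂ) (s : Finset ι) :
    X.det ≤ (X + ∑ i ∈ s, γ i • Matrix.vecMulVec (v i) (star (v i))).det := by
  classical
  induction s using Finset.induction_on with
  | empty => simp
  | insert i s hi ih =>
    rw [Finset.sum_insert hi, add_comm (γ i • _), ← add_assoc]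
    refine ih.trans (Matrix.PosSemidef.det_le_det_add_smul_vecMulVec (hX.add ?_) (hγ i) _)
    exact Matrix.posSemidef_sum _ fun j _ => Matrix.PosSemidef.smul_vecMulVec_self_star (hγ j) _


/-- Averaging the quadratic form `P` over rank-one perturbations `U + b hᵢ` of `U` with a common
column `b` decreases the determinant by at most the probability that there is no perturbation. -/
lemma Matrix.PosSemidef.mul_det_le_det_sum_rankOne [Fintype n] [Fintype ι] {P : Matrix n n ℂ}
    (hP : P.PosSemidef) (U : Matrix n m ℂ) (b : n → ℂ) (h : ι → m → ℂ) {p : ι → ℝ}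
    (hp : ∀ i, 0 ≤ p i) (hsum : ∑ i, p i = 1) (Z : Finset ι) (hZ : ∀ i ∈ Z, h i = 0) :
    ((∑ i ∈ Z, p i : ℝ) : ℂ) * (Uᴴ * P * U).det ≤
      (∑ i, (p i : ℂ) • ((U + Matrix.vecMulVec b (h i))ᴴ * P *
        (U + Matrix.vecMulVec b (h i)))).det := by
  classical
  have hp' : ∀ i, (0 : ℂ) ≤ (p i : ℂ) := fun i => by exact_mod_cast hp i
  have hsum' : ∑ i, (p i : ℂ) = 1 := by exact_mod_cast hsum
  have hQ : (Uᴴ * P * U).PosSemidef := hP.conjTranspose_mul_mul_same U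
  have hY := Matrix.posSemidef_sum (R := ℂ) Finset.univ (fun i (_ : i ∈ Finset.univ) =>
    (hP.conjTranspose_mul_mul_same (U + Matrix.vecMulVec b (h i))).smul (hp' i))
  have hα1 : (0 : ℂ) ≤ 1 - ((∑ i ∈ Z, p i : ℝ) : ℂ) := by
    have : ∑ i ∈ Z, p i ≤ 1 := hsum ▸
      Finset.sum_le_sum_of_subset_of_nonneg (Finset.subset_univ _) fun i _ _ => hp i
    exact_mod_cast sub_nonneg.mpr this
  by_cases h0 : (Uᴴ * P * U).det = 0
  · rw [h0, mul_zero]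
    exact hY.det_nonneg
  set β : ℂ := star b ⬝ᵥ (P *ᵥ b) with hβ
  have hβ0 : 0 ≤ β := hP.dotProduct_mulVec_nonneg b
  by_cases hb : β = 0
  -- If `b` is null for `P`, the perturbations are invisible and it remains to use that the weight
  -- of `Z` is at most one.
  · have hPb : P *ᵥ b = 0 := (hP.dotProduct_mulVec_zero_iff b).mp hb
    have : ∀ i, (U + Matrix.vecMulVec b (h i))ᴴ * P * (U + Matrix.vecMulVec b (h i))
        = Uᴴ * P * U := fun i => by
      rw [hP.conjTranspose_add_vecMulVec U b (by simp [hPb]), ← hβ, hb, zero_smul, add_zero]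
    simp_rw [this, ← Finset.sum_smul, hsum', one_smul]
    have := mul_nonneg hα1 hQ.det_nonneg
    rwa [sub_mul, one_mul, sub_nonneg] at this
  set c : m → ℂ := Uᴴ *ᵥ (P *ᵥ b) with hc
  -- Complete the square: `V` removes from the columns of `U` their `P`-component along `b`. With
  -- the row `g = β⁻¹ • star c`, each perturbed form becomes `VᴴPV + β (g + hᵢ)ᴴ(g + hᵢ)`.
  set V : Matrix n m ℂ := U - Matrix.vecMulVec b (β⁻¹ • star c) with hV
  have hstarβ : star β = β := by
    have : IsSelfAdjoint β := IsSelfAdjoint.of_nonneg hβ0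
    exact this
  have hVb : Vᴴ *ᵥ (P *ᵥ b) = 0 := by
    rw [hV, Matrix.conjTranspose_sub, Matrix.sub_mulVec, ← hc, Matrix.conjTranspose_vecMulVec,
      Matrix.vecMulVec_mulVec, ← hβ, star_smul, star_star, star_inv₀, hstarβ]
    ext j
    simp [hb]
  have hUV : ∀ i, U + Matrix.vecMulVec b (h i) = V + Matrix.vecMulVec b (β⁻¹ • star c + h i) := by
    intro i
    rw [hV, Matrix.vecMulVec_add]
    abel
  have hR : (Vᴴ * P * V).PosSemidef := hP.conjTranspose_mul_mul_same V
  have hexp : ∀ i, (U + Matrix.vecMulVec b (h i))ᴴ * P * (U + Matrix.vecMulVec b (h i))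
      = Vᴴ * P * V + β • Matrix.vecMulVec (star (β⁻¹ • star c + h i)) (β⁻¹ • star c + h i) :=
    fun i => by rw [hUV, hP.conjTranspose_add_vecMulVec V b hVb]
  have hQV : Uᴴ * P * U
      = Vᴴ * P * V + Matrix.vecMulVec (β • star (β⁻¹ • star c)) (β⁻¹ • star c) := by
    have : U = V + Matrix.vecMulVec b (β⁻¹ • star c) := by rw [hV]; abel
    conv_lhs => rw [this]
    rw [hP.conjTranspose_add_vecMulVec V b hVb, ← hβ, Matrix.smul_vecMulVec]
  -- The indices in `Z` all contribute the same term `gᴴg`; the others contribute positive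
  -- semidefinite terms that only increase the determinant.
  have hYV : ∑ i, (p i : ℂ) • ((U + Matrix.vecMulVec b (h i))ᴴ * P *
        (U + Matrix.vecMulVec b (h i)))
      = (Vᴴ * P * V + ((∑ i ∈ Z, p i : ℝ) : ℂ) •
          Matrix.vecMulVec (β • star (β⁻¹ • star c)) (β⁻¹ • star c))
        + ∑ i ∈ Zᶜ, ((p i : ℂ) * β) • Matrix.vecMulVec (star (β⁻¹ • star c + h i))
          (star (star (β⁻¹ • star c + h i))) := by
    simp_rw [hexp, smul_add, Finset.sum_add_distrib, ← Finset.sum_smul, hsum', one_smul, add_assoc,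
      ← Finset.sum_add_sum_compl Z, smul_smul, star_star]
    congr 2
    rw [Complex.ofReal_sum, Finset.sum_smul]
    refine Finset.sum_congr rfl fun i hi => ?_
    rw [hZ i hi, add_zero, Matrix.smul_vecMulVec, smul_smul]
  have hmid : (Vᴴ * P * V + ((∑ i ∈ Z, p i : ℝ) : ℂ) •
      Matrix.vecMulVec (β • star (β⁻¹ • star c)) (β⁻¹ • star c)).PosSemidef := by
    refine hR.add ?_
    rw [Matrix.smul_vecMulVec, smul_smul]
    have := Matrix.PosSemidef.smul_vecMulVec_self_star
      (γ := ((∑ i ∈ Z, p i : ℝ) : ℂ) * β)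
      (mul_nonneg (by exact_mod_cast Finset.sum_nonneg fun i _ => hp i) hβ0)
      (star (β⁻¹ • star c))
    rwa [star_star] at this
  rw [hYV]
  refine le_trans ?_ (hmid.det_le_det_add_sum (fun i => mul_nonneg (hp' i) hβ0) _ _)
  -- By affinity, with `α` the weight of `Z`, this determinant is `α det(UᴴPU) + (1 - α) det(VᴴPV)`;
  -- the second summand is dropped.
  rw [Matrix.det_add_smul_vecMulVec _ _ (by rwa [← hQV]), ← hQV]
  exact le_add_of_nonneg_right (mul_nonneg hα1 hR.det_nonneg)

lemma Matrix.PosSemidef.det_le_trace_pow {X : Matrix m m ℂ} (hX : X.PosSemidef) :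
    X.det.re ≤ X.trace.re ^ Fintype.card m := by
  rw [hX.1.det_eq_prod_eigenvalues, hX.1.trace_eq_sum_eigenvalues]
  have h1 : (∏ i, ((hX.1.eigenvalues i : ℝ) : ℂ)).re = ∏ i, hX.1.eigenvalues i := by
    rw [← Complex.ofReal_prod, Complex.ofReal_re]
  have h2 : (∑ i, ((hX.1.eigenvalues i : ℝ) : ℂ)).re = ∑ i, hX.1.eigenvalues i := by
    rw [← Complex.ofReal_sum, Complex.ofReal_re]
  refine (h1.trans_le ?_).trans_eq (congrArg (· ^ _) h2.symm)
  rw [← Finset.card_univ, ← Finset.prod_const]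
  exact Finset.prod_le_prod (fun i _ => hX.eigenvalues_nonneg i) fun i _ =>
    Finset.single_le_sum (fun j _ => hX.eigenvalues_nonneg j) (Finset.mem_univ i)

end RankOne

/-! ### Invariant subspaces with prescribed eigenvalues. -/

section InvariantSubspace

/-- In a basis that contains an eigenvector, a matrix is block triangular. -/
lemma Matrix.exists_mul_eq_mul_fromBlocks {n : ℕ} (A : Matrix (Fin (n + 1)) (Fin (n + 1)) ℂ)
    {l : ℂ} (hl : l ∈ A.charpoly.roots) :
    ∃ (S : Matrix (Fin (n + 1)) (Fin 1 ⊕ Fin n) ℂ) (S' : Matrix (Fin 1 ⊕ Fin n) (Fin (n + 1)) ℂ)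
      (r : Matrix (Fin 1) (Fin n) ℂ) (A' : Matrix (Fin n) (Fin n) ℂ),
      S' * S = 1 ∧ S * S' = 1 ∧ A * S = S * Matrix.fromBlocks (l • 1) r 0 A' := by
  classical
  have hroot : Module.End.HasEigenvalue (Matrix.toLin' A) l := by
    rw [Module.End.hasEigenvalue_iff_isRoot_charpoly]
    simpa using Polynomial.isRoot_of_mem_roots hl
  obtain ⟨v, hv⟩ := hroot.exists_hasEigenvector
  have hAv : A *ᵥ v = l • v := by simpa using hv.apply_eq_smul
  obtain ⟨k, hk⟩ := Function.ne_iff.mp hv.2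
  -- Replacing the `k`-th standard basis vector by `v` gives a basis because `v k ≠ 0`: by Cramer's
  -- rule this entry is the determinant.
  set W : Matrix (Fin (n + 1)) (Fin (n + 1)) ℂ := (1 : Matrix _ _ ℂ).updateCol k v with hW
  have hdet : IsUnit W.det := by
    have : W.det = v k := by
      rw [hW, ← Matrix.cramer_apply, Matrix.cramer_one]
      rfl
    rw [this]
    exact isUnit_iff_ne_zero.mpr hk
  have hWk : W *ᵥ Pi.single k 1 = v := by
    rw [Matrix.mulVec_single_one]
    ext i
    simp [hW, Matrix.col]
  have hcol : (W⁻¹ * A * W) *ᵥ Pi.single k 1 = l • Pi.single k 1 := by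
    rw [← Matrix.mulVec_mulVec, hWk, ← Matrix.mulVec_mulVec, hAv, Matrix.mulVec_smul, ← hWk,
      Matrix.mulVec_mulVec, Matrix.nonsing_inv_mul _ hdet, Matrix.one_mulVec]
  have hentry : ∀ i, (W⁻¹ * A * W) i k = l * (Pi.single k 1 : Fin (n + 1) → ℂ) i := fun i => by
    have := congrFun hcol i
    rwa [Matrix.mulVec_single_one] at this
  obtain ⟨e, he⟩ : ∃ e : Fin 1 ⊕ Fin n ≃ Fin (n + 1), e (Sum.inl 0) = k := by
    let e₀ : Fin 1 ⊕ Fin n ≃ Fin (n + 1) := finSumFinEquiv.trans (finCongr (add_comm 1 n))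
    exact ⟨e₀.trans (Equiv.swap (e₀ (Sum.inl 0)) k), by simp⟩
  have hblock : (W⁻¹ * A * W).submatrix e e = Matrix.fromBlocks (l • 1)
      ((W⁻¹ * A * W).submatrix e e).toBlocks₁₂ 0 ((W⁻¹ * A * W).submatrix e e).toBlocks₂₂ := by
    conv_lhs => rw [← Matrix.fromBlocks_toBlocks ((W⁻¹ * A * W).submatrix e e)]
    congr 1
    · ext i j
      rw [Subsingleton.elim i 0, Subsingleton.elim j 0]
      simp [Matrix.toBlocks₁₁, he, hentry]
    · ext i j
      rw [Subsingleton.elim j 0]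
      have : e (Sum.inr i) ≠ k := fun h => by simpa using e.injective (h.trans he.symm)
      simp [Matrix.toBlocks₂₁, he, hentry, this]
  refine ⟨W.submatrix id e, W⁻¹.submatrix e id, ((W⁻¹ * A * W).submatrix e e).toBlocks₁₂,
    ((W⁻¹ * A * W).submatrix e e).toBlocks₂₂, ?_, ?_, ?_⟩
  · rw [← Matrix.submatrix_mul _ _ _ _ _ Function.bijective_id, Matrix.nonsing_inv_mul _ hdet,
      Matrix.submatrix_one_equiv]
  · rw [← Matrix.submatrix_mul _ _ _ _ _ e.bijective, Matrix.mul_nonsing_inv _ hdet,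
      Matrix.submatrix_id_id]
  · rw [← hblock, ← Matrix.submatrix_mul _ _ _ _ _ e.bijective, ← Matrix.mul_assoc,
      ← Matrix.mul_assoc, Matrix.mul_nonsing_inv _ hdet, Matrix.one_mul]
    rfl

open Classical in
/-- For every set of complex numbers, a matrix has an invariant subspace on which it has exactly
its eigenvalues in that set, with their algebraic multiplicities. -/
lemma Matrix.exists_invariant_det (q : ℂ → Prop) {n : ℕ} (A : Matrix (Fin n) (Fin n) ℂ) :
    ∃ (m : ℕ) (U : Matrix (Fin n) (Fin m) ℂ) (V : Matrix (Fin m) (Fin n) ℂ)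
      (T : Matrix (Fin m) (Fin m) ℂ), V * U = 1 ∧ A * U = U * T ∧
        T.det = (A.charpoly.roots.filter q).prod := by
  have hnone : ∀ {n : ℕ} (A : Matrix (Fin n) (Fin n) ℂ), A.charpoly.roots.filter q = 0 →
      ∃ (m : ℕ) (U : Matrix (Fin n) (Fin m) ℂ) (V : Matrix (Fin m) (Fin n) ℂ)
      (T : Matrix (Fin m) (Fin m) ℂ), V * U = 1 ∧ A * U = U * T ∧
        T.det = (A.charpoly.roots.filter q).prod := fun A h =>
    ⟨0, 0, 0, 0, Subsingleton.elim _ _, Matrix.ext fun _ j => j.elim0, by simp [h]⟩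
  -- Only eigenvalues satisfying `q` are split off; once none is left, the zero subspace suffices,
  -- with empty determinant 1.
  induction n with
  | zero =>
    refine hnone A ?_
    rw [Matrix.charpoly, Matrix.det_isEmpty]
    simp
  | succ n ih =>
    by_cases h0 : A.charpoly.roots.filter q = 0
    · exact hnone A h0
    obtain ⟨l, hl⟩ := Multiset.exists_mem_of_ne_zero h0
    obtain ⟨hl, hql⟩ := Multiset.mem_filter.mp hl
    obtain ⟨S, S', r, A', h1, h2, h3⟩ := A.exists_mul_eq_mul_fromBlocks hl
    obtain ⟨m, U, V, T, hVU, hAU, hT⟩ := ih A'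
    set B : Matrix (Fin 1 ⊕ Fin n) (Fin 1 ⊕ Fin n) ℂ := Matrix.fromBlocks (l • 1) r 0 A' with hB
    have hchar : A.charpoly = (Polynomial.X - Polynomial.C l) * A'.charpoly := by
      have hA : A = S * (B * S' : Matrix (Fin 1 ⊕ Fin n) (Fin (n + 1)) ℂ) := by
        rw [← Matrix.mul_assoc, ← h3, Matrix.mul_assoc, h2, Matrix.mul_one]
      have := Matrix.charpoly_mul_comm' S (B * S' : Matrix (Fin 1 ⊕ Fin n) (Fin (n + 1)) ℂ)
      rw [← hA, Matrix.mul_assoc, h1, Matrix.mul_one, hB, Matrix.charpoly_fromBlocks_zero₂₁] at this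
      simp only [Fintype.card_fin, Fintype.card_sum, add_comm 1 n] at this
      rw [mul_left_cancel₀ (pow_ne_zero _ Polynomial.X_ne_zero) this]
      congr 1
      simp [Matrix.charpoly, Matrix.charmatrix, Matrix.det_unique]
    have hroots : A.charpoly.roots = l ::ₘ A'.charpoly.roots := by
      rw [hchar, Polynomial.roots_mul, Polynomial.roots_X_sub_C]
      · rfl
      · exact mul_ne_zero (Polynomial.X_sub_C_ne_zero l) A'.charpoly_monic.ne_zero
    -- The subspace is spanned by the eigenvector and a lift of the invariant subspace of the
    -- quotient block `A'`.
    set U₁ : Matrix (Fin 1 ⊕ Fin n) (Fin 1 ⊕ Fin m) ℂ := Matrix.fromBlocks 1 0 0 U with hU₁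
    set V₁ : Matrix (Fin 1 ⊕ Fin m) (Fin 1 ⊕ Fin n) ℂ := Matrix.fromBlocks 1 0 0 V with hV₁
    set T₁ : Matrix (Fin 1 ⊕ Fin m) (Fin 1 ⊕ Fin m) ℂ :=
      Matrix.fromBlocks (l • 1) (r * U) 0 T with hT₁
    have hVU₁ : V₁ * U₁ = 1 := by
      rw [hU₁, hV₁, Matrix.fromBlocks_multiply]
      simp [hVU]
    have hBU₁ : B * U₁ = U₁ * T₁ := by
      rw [hB, hU₁, hT₁, Matrix.fromBlocks_multiply, Matrix.fromBlocks_multiply]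
      simp [hAU]
    let e : Fin (1 + m) ≃ Fin 1 ⊕ Fin m := finSumFinEquiv.symm
    refine ⟨1 + m, S * U₁.submatrix id e, V₁.submatrix e id * S', T₁.submatrix e e, ?_, ?_, ?_⟩
    · rw [Matrix.mul_assoc, ← Matrix.mul_assoc S', h1, Matrix.one_mul,
        ← Matrix.submatrix_mul _ _ _ _ _ Function.bijective_id, hVU₁, Matrix.submatrix_one_equiv]
    · rw [← Matrix.mul_assoc, h3, Matrix.mul_assoc, Matrix.mul_assoc,
        ← Matrix.submatrix_mul _ _ _ _ _ e.bijective, ← hBU₁,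
        Matrix.submatrix_mul _ _ _ _ _ Function.bijective_id, Matrix.submatrix_id_id]
    · rw [Matrix.det_submatrix_equiv_self, hT₁, Matrix.det_fromBlocks_zero₂₁, hT, hroots,
        Multiset.filter_cons_of_pos _ hql, Multiset.prod_cons]
      simp

end InvariantSubspace

/-! ### Forward covariances, backward costs, and their compressed determinants. -/

section Moments

open scoped ComplexOrder

variable {ι n m : Type*} [Fintype ι] [Fintype n]

/-- The average of the quadratic form `X` pulled back along the matrices `H i`, with weights
`p i`. -/
def momentStep (p : ι → ℝ) (H : ι → Matrix n n ℂ) (X : Matrix n n ℂ) : Matrix n n ℂ :=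
  ∑ i, (p i : ℂ) • ((H i)ᴴ * X * H i)

/-- The second moment at time `k` of a random linear recursion with matrices `M k i`, if it is `S`
at time `0`. -/
def covarianceIter (p : ι → ℝ) (M : ℕ → ι → Matrix n n ℂ) (S : Matrix n n ℂ) :
    ℕ → Matrix n n ℂ
  | 0 => S
  | k + 1 => momentStep p (fun i => (M k i)ᴴ) (covarianceIter p M S k)

/-- The expected value of the quadratic form `Q` of the state at time `k`, as a quadratic form of
the initial state. -/
def costIter (p : ι → ℝ) (M : ℕ → ι → Matrix n n ℂ) : ℕ → Matrix n n ℂ → Matrix n n ℂ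
  | 0, Q => Q
  | k + 1, Q => costIter p M k (momentStep p (M k) Q)

lemma Matrix.PosSemidef.momentStep {p : ι → ℝ} (hp : ∀ i, 0 ≤ p i) (H : ι → Matrix n n ℂ)
    {X : Matrix n n ℂ} (hX : X.PosSemidef) : (momentStep p H X).PosSemidef :=
  Matrix.posSemidef_sum _ fun i _ => (hX.conjTranspose_mul_mul_same (H i)).smul
    (by exact_mod_cast hp i)

lemma Matrix.PosSemidef.covarianceIter {p : ι → ℝ} (hp : ∀ i, 0 ≤ p i)
    (M : ℕ → ι → Matrix n n ℂ) {S : Matrix n n ℂ} (hS : S.PosSemidef) (k : ℕ) :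
    (covarianceIter p M S k).PosSemidef := by
  induction k with
  | zero => exact hS
  | succ k ih => exact ih.momentStep hp _

lemma Matrix.PosSemidef.costIter {p : ι → ℝ} (hp : ∀ i, 0 ≤ p i) (M : ℕ → ι → Matrix n n ℂ)
    (k : ℕ) {Q : Matrix n n ℂ} (hQ : Q.PosSemidef) : (costIter p M k Q).PosSemidef := by
  induction k generalizing Q with
  | zero => exact hQ
  | succ k ih => exact ih (hQ.momentStep hp _)

lemma trace_momentStep_mul (p : ι → ℝ) (H : ι → Matrix n n ℂ) (X Y : Matrix n n ℂ) :
    (X * momentStep p (fun i => (H i)ᴴ) Y).trace = (momentStep p H X * Y).trace := by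
  simp only [momentStep, Finset.mul_sum, Finset.sum_mul, Matrix.trace_sum, Matrix.mul_smul,
    Matrix.smul_mul, Matrix.trace_smul, Matrix.conjTranspose_conjTranspose]
  refine Finset.sum_congr rfl fun i _ => ?_
  congr 1
  rw [← Matrix.mul_assoc, Matrix.trace_mul_comm]
  simp only [Matrix.mul_assoc]

/-- Propagating the covariance forward and the cost backward are adjoint for the trace pairing. This
lets the observer bound work with covariances. -/
lemma trace_mul_covarianceIter (p : ι → ℝ) (M : ℕ → ι → Matrix n n ℂ) (S Q : Matrix n n ℂ)
    (k : ℕ) : (Q * covarianceIter p M S k).trace = (costIter p M k Q * S).trace := by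
  induction k generalizing Q with
  | zero => rfl
  | succ k ih => rw [covarianceIter, costIter, trace_momentStep_mul, ih]

section Determinant

variable [Fintype m] [DecidableEq m] {p : ι → ℝ}

lemma det_momentStep_ge (hp : ∀ i, 0 ≤ p i) (hsum : ∑ i, p i = 1) {H : ι → Matrix n n ℂ}
    {U : Matrix n m ℂ} {T : Matrix m m ℂ} {b : n → ℂ} {h : ι → m → ℂ}
    (hH : ∀ i, H i * U = U * T + Matrix.vecMulVec b (h i)) {Z : Finset ι}
    (hZ : ∀ i ∈ Z, h i = 0) {X : Matrix n n ℂ} (hX : X.PosSemidef) :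
    (∑ i ∈ Z, p i) * ‖T.det‖ ^ 2 * (Uᴴ * X * U).det.re ≤ (Uᴴ * momentStep p H X * U).det.re := by
  have h1 : Uᴴ * momentStep p H X * U = ∑ i, (p i : ℂ) • ((U * T + Matrix.vecMulVec b (h i))ᴴ * X *
      (U * T + Matrix.vecMulVec b (h i))) := by
    simp only [momentStep, Matrix.mul_sum, Matrix.sum_mul, Matrix.mul_smul, Matrix.smul_mul, ← hH,
      Matrix.conjTranspose_mul, Matrix.mul_assoc]
  have h2 : ((U * T)ᴴ * X * (U * T)).det = ((‖T.det‖ ^ 2 : ℝ) : ℂ) * (Uᴴ * X * U).det := by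
    have : (U * T)ᴴ * X * (U * T) = Tᴴ * (Uᴴ * X * U) * T := by
      simp only [Matrix.conjTranspose_mul, Matrix.mul_assoc]
    rw [this, Matrix.det_mul, Matrix.det_mul, Matrix.det_conjTranspose, Complex.ofReal_pow,
      ← Complex.conj_mul', Complex.star_def]
    ring
  have h3 := (Complex.le_def.mp
    (hX.mul_det_le_det_sum_rankOne (U * T) b h hp hsum Z hZ)).1
  rw [h1]
  rwa [h2, ← mul_assoc, ← Complex.ofReal_mul, Complex.re_ofReal_mul] at h3

variable {M : ℕ → ι → Matrix n n ℂ} {U : Matrix n m ℂ} {T : Matrix m m ℂ} {b : ℕ → n → ℂ}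
  {h : ℕ → ι → m → ℂ} {Z : ℕ → Finset ι}

/-- `Z` may vary with time, so that times without transmission can take all indices and lose
nothing. -/
lemma det_costIter_ge (hp : ∀ i, 0 ≤ p i) (hsum : ∑ i, p i = 1)
    (hM : ∀ k i, M k i * U = U * T + Matrix.vecMulVec (b k) (h k i))
    (hZ : ∀ k, ∀ i ∈ Z k, h k i = 0) {Q : Matrix n n ℂ} (hQ : Q.PosSemidef) (K : ℕ) :
    (∏ k ∈ Finset.range K, ((∑ i ∈ Z k, p i) * ‖T.det‖ ^ 2)) * (Uᴴ * Q * U).det.re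
      ≤ (Uᴴ * costIter p M K Q * U).det.re := by
  induction K generalizing Q with
  | zero => simp [costIter]
  | succ K ih =>
    refine le_trans ?_ (ih (hQ.momentStep hp _))
    rw [Finset.prod_range_succ, mul_assoc]
    refine mul_le_mul_of_nonneg_left (det_momentStep_ge hp hsum (hM K) (hZ K) hQ) ?_
    exact Finset.prod_nonneg fun k _ => mul_nonneg (Finset.sum_nonneg fun i _ => hp i)
      (sq_nonneg _)

lemma det_covarianceIter_ge (hp : ∀ i, 0 ≤ p i) (hsum : ∑ i, p i = 1)
    (hM : ∀ k i, (M k i)ᴴ * U = U * T + Matrix.vecMulVec (b k) (h k i))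
    (hZ : ∀ k, ∀ i ∈ Z k, h k i = 0) {S : Matrix n n ℂ} (hS : S.PosSemidef) (K : ℕ) :
    (∏ k ∈ Finset.range K, ((∑ i ∈ Z k, p i) * ‖T.det‖ ^ 2)) * (Uᴴ * S * U).det.re
      ≤ (Uᴴ * covarianceIter p M S K * U).det.re := by
  induction K with
  | zero => simp [covarianceIter]
  | succ K ih =>
    refine le_trans ?_ (det_momentStep_ge hp hsum (hM K) (hZ K) (hS.covarianceIter hp M K))
    rw [Finset.prod_range_succ, mul_comm (∏ k ∈ _, _), mul_assoc]
    exact mul_le_mul_of_nonneg_left ih (mul_nonneg (Finset.sum_nonneg fun i _ => hp i)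
      (sq_nonneg _))

end Determinant

end Moments

/-! ### Trajectories as functions of the past choices. -/

section Trajectory

variable {ι n R : Type*} [Fintype n]

/-- The trajectory of `w (k+1) = M k (σ k) (w k)` from the initial state `w`. -/
def linearTrajectory [NonUnitalNonAssocSemiring R] (M : ℕ → ι → Matrix n n R) (σ : ℕ → ι)
    (w : n → R) : ℕ → n → R
  | 0 => w
  | k + 1 => M k (σ k) *ᵥ linearTrajectory M σ w k

/-- The state at time `k` depends only on the choices before time `k`. -/
lemma exists_linearTrajectory_eq [NonUnitalNonAssocSemiring R] (M : ℕ → ι → Matrix n n R)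
    (w : n → R) (k : ℕ) :
    ∃ g : (Finset.range k → ι) → n → R,
      ∀ σ : ℕ → ι, linearTrajectory M σ w k = g fun j => σ j := by
  induction k with
  | zero => exact ⟨fun _ => w, fun _ => rfl⟩
  | succ k ih =>
    obtain ⟨g, hg⟩ := ih
    refine ⟨fun s => M k (s ⟨k, by simp⟩) *ᵥ
      g fun j => s ⟨j, Finset.range_mono (Nat.le_succ k) j.2⟩, fun σ => ?_⟩
    rw [linearTrajectory, hg]

/-- Stability concerns real initial states, whereas the unstable subspace is complex; real matrices
act separately on real and imaginary parts. -/
lemma linearTrajectory_ofReal (M : ℕ → ι → Matrix n n ℝ) (σ : ℕ → ι) (w : n → ℂ) (k : ℕ) (a : n) :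
    linearTrajectory (fun k i => (M k i).map Complex.ofReal) σ w k a
      = ((linearTrajectory M σ (fun j => (w j).re) k a : ℝ) : ℂ)
        + ((linearTrajectory M σ (fun j => (w j).im) k a : ℝ) : ℂ) * Complex.I := by
  induction k generalizing a with
  | zero => simp [linearTrajectory]
  | succ k ih =>
    simp only [linearTrajectory, Matrix.mulVec, dotProduct, Matrix.map_apply, ih,
      Complex.ofReal_sum, Complex.ofReal_mul, Finset.sum_mul, ← Finset.sum_add_distrib]
    exact Finset.sum_congr rfl fun j _ => by ring

lemma sum_norm_sq_linearTrajectory_ofReal (M : ℕ → ι → Matrix n n ℝ) (σ : ℕ → ι) (w : n → ℂ)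
    (k : ℕ) :
    ∑ a, ‖linearTrajectory (fun k i => (M k i).map Complex.ofReal) σ w k a‖ ^ 2
      = ∑ a, linearTrajectory M σ (fun j => (w j).re) k a ^ 2
        + ∑ a, linearTrajectory M σ (fun j => (w j).im) k a ^ 2 := by
  rw [← Finset.sum_add_distrib]
  refine Finset.sum_congr rfl fun a _ => ?_
  rw [linearTrajectory_ofReal, ← Complex.normSq_eq_norm_sq, Complex.normSq_add_mul_I]

end Trajectory

/-! ### Second moments under independent choices. -/

section IndependentChoices

variable {ι n m r Ω : Type*} [Fintype ι] [MeasurableSpace ι] [MeasurableSingletonClass ι]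
  [Fintype n] [MeasurableSpace Ω] {P : Measure Ω} [IsProbabilityMeasure P] {τ : ℕ → Ω → ι}

/-- A finite history takes finitely many values, so no growth condition is needed. -/
lemma integrable_comp_history {E : Type*} [NormedAddCommGroup E] (hτ : ∀ k, Measurable (τ k))
    (k : ℕ) (g : (Finset.range k → ι) → E) :
    Integrable (fun ω => g fun j => τ j ω) P := by
  have hmeas : Measurable fun ω (j : Finset.range k) => τ j ω :=
    measurable_pi_lambda _ fun j => hτ j
  have : IsProbabilityMeasure (P.map fun ω (j : Finset.range k) => τ j ω) :=
    Measure.isProbabilityMeasure_map hmeas.aemeasurable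
  exact (Integrable.of_finite (f := g)).comp_measurable hmeas

lemma integrable_comp_linearTrajectory {E R : Type*} [NormedAddCommGroup E]
    [NonUnitalNonAssocSemiring R] (hτ : ∀ k, Measurable (τ k)) (M : ℕ → ι → Matrix n n R)
    (w : n → R) (k : ℕ) (F : (n → R) → E) :
    Integrable (fun ω => F (linearTrajectory M (fun j => τ j ω) w k)) P := by
  obtain ⟨g, hg⟩ := exists_linearTrajectory_eq M w k
  simp_rw [hg]
  exact integrable_comp_history hτ k (F ∘ g)

/-- The state at time `k` depends on earlier choices only, hence is independent of the choice `τ k`,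
which can be averaged out first. -/
lemma integral_comp_linearTrajectory {R : Type*} [NonUnitalNonAssocSemiring R]
    (hτ : ∀ k, Measurable (τ k)) (hindep : iIndepFun τ P) {p : ι → ℝ}
    (hp : ∀ k i, P.real {ω | τ k ω = i} = p i) (M : ℕ → ι → Matrix n n R) (w : n → R) (k : ℕ)
    (F : ι → (n → R) → ℂ) :
    ∫ ω, F (τ k ω) (linearTrajectory M (fun j => τ j ω) w k) ∂P
      = ∑ i, (p i : ℂ) * ∫ ω, F i (linearTrajectory M (fun j => τ j ω) w k) ∂P := by
  classical
  obtain ⟨g, hg⟩ := exists_linearTrajectory_eq M w k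
  simp_rw [hg]
  have hdisj : Disjoint ({k} : Finset ℕ) (Finset.range k) := by simp
  have hind := hindep.indepFun_finset _ _ hdisj hτ
  have hsplit : ∀ ω, F (τ k ω) (g fun j => τ j ω)
      = ∑ i, (if τ k ω = i then (1 : ℂ) else 0) * F i (g fun j => τ j ω) := fun ω => by simp
  have hmeas : ∀ S : Finset ℕ, Measurable fun ω (j : S) => τ j ω := fun S =>
    measurable_pi_lambda _ fun j => hτ j
  have hint : ∀ i, ∫ ω, (if τ k ω = i then (1 : ℂ) else 0) * F i (g fun j => τ j ω) ∂P
      = (p i : ℂ) * ∫ ω, F i (g fun j => τ j ω) ∂P := fun i => by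
    have h1 := hind.integral_fun_comp_mul_comp (𝕜 := ℂ)
      (f := fun s => if s ⟨k, by simp⟩ = i then (1 : ℂ) else 0) (g := fun s => F i (g s))
      (hmeas _).aemeasurable (hmeas _).aemeasurable
      (measurable_of_finite _).aestronglyMeasurable (measurable_of_finite _).aestronglyMeasurable
    rw [h1]
    congr 1
    have hset : MeasurableSet {ω | τ k ω = i} := hτ k (measurableSet_singleton i)
    have : (fun ω => if τ k ω = i then (1 : ℂ) else 0)
        = {ω | τ k ω = i}.indicator fun _ => (1 : ℂ) := by
      ext ω
      simp [Set.indicator_apply]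
    rw [this, integral_indicator_const _ hset, hp]
    simp
  simp_rw [hsplit]
  rw [integral_finsetSum]
  · exact Finset.sum_congr rfl fun i _ => hint i
  · intro i _
    have hmem : ∀ j : Finset.range k, (j : ℕ) ∈ Finset.range (k + 1) := fun j =>
      Finset.range_mono (Nat.le_succ k) j.2
    exact integrable_comp_history (P := P) hτ (k + 1) fun s =>
      (if s ⟨k, by simp⟩ = i then (1 : ℂ) else 0) * F i (g fun j => s ⟨j, hmem j⟩)

lemma integral_quadratic_linearTrajectory (hτ : ∀ k, Measurable (τ k)) (hindep : iIndepFun τ P)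
    {p : ι → ℝ} (hp : ∀ k i, P.real {ω | τ k ω = i} = p i) (M : ℕ → ι → Matrix n n ℂ)
    (Q : Matrix n n ℂ) (w : n → ℂ) (k : ℕ) :
    ∫ ω, star (linearTrajectory M (fun j => τ j ω) w k) ⬝ᵥ
        (Q *ᵥ linearTrajectory M (fun j => τ j ω) w k) ∂P
      = star w ⬝ᵥ (costIter p M k Q *ᵥ w) := by
  induction k generalizing Q with
  | zero => simp [linearTrajectory, costIter]
  | succ k ih =>
    rw [costIter, ← ih]
    simp only [linearTrajectory]
    rw [integral_comp_linearTrajectory hτ hindep hp M w k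
      fun i v => star (M k i *ᵥ v) ⬝ᵥ (Q *ᵥ (M k i *ᵥ v))]
    simp_rw [← integral_const_mul]
    rw [← integral_finsetSum]
    · refine integral_congr_ae (ae_of_all _ fun ω => ?_)
      simp only [momentStep, Matrix.sum_mulVec, dotProduct_sum, Matrix.smul_mulVec,
        dotProduct_smul, smul_eq_mul]
      refine Finset.sum_congr rfl fun i _ => ?_
      rw [Matrix.star_mulVec, ← Matrix.dotProduct_mulVec, Matrix.mulVec_mulVec,
        Matrix.mulVec_mulVec, Matrix.mul_assoc]
    · exact fun i _ => integrable_comp_linearTrajectory hτ M w k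
        fun v => (p i : ℂ) * (star (M k i *ᵥ v) ⬝ᵥ (Q *ᵥ (M k i *ᵥ v)))

/-- If the second moment of every real trajectory tends to zero, then so does every quadratic
functional of the trajectories. -/
lemma tendsto_trace_costIter [Fintype m] [Fintype r] (hτ : ∀ k, Measurable (τ k))
    (hindep : iIndepFun τ P) {p : ι → ℝ} (hp : ∀ k i, P.real {ω | τ k ω = i} = p i)
    (M : ℕ → ι → Matrix n n ℝ)
    (hM : ∀ w : n → ℝ, Tendsto
      (fun k => ∫ ω, ∑ a, linearTrajectory M (fun j => τ j ω) w k a ^ 2 ∂P) atTop (𝓝 0))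
    (R : Matrix r n ℂ) (U : Matrix n m ℂ) :
    Tendsto (fun k => (Uᴴ * costIter p (fun k i => (M k i).map Complex.ofReal) k (Rᴴ * R)
      * U).trace.re) atTop (𝓝 0) := by
  set Mc : ℕ → ι → Matrix n n ℂ := fun k i => (M k i).map Complex.ofReal with hMc
  have hc : ∀ w : n → ℂ, Tendsto
      (fun k => ∫ ω, ∑ a, ‖linearTrajectory Mc (fun j => τ j ω) w k a‖ ^ 2 ∂P) atTop (𝓝 0) := by
    intro w
    have h := (hM fun j => (w j).re).add (hM fun j => (w j).im)
    rw [add_zero] at h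
    refine h.congr fun k => ?_
    rw [← integral_add]
    · simp_rw [hMc, sum_norm_sq_linearTrajectory_ofReal]
    · exact integrable_comp_linearTrajectory hτ M _ k fun v => ∑ a, v a ^ 2
    · exact integrable_comp_linearTrajectory hτ M _ k fun v => ∑ a, v a ^ 2
  have hquad : ∀ v : n → ℂ, star v ⬝ᵥ ((Rᴴ * R) *ᵥ v)
      = ((∑ l, ‖(R *ᵥ v) l‖ ^ 2 : ℝ) : ℂ) := fun v => by
    rw [← Matrix.mulVec_mulVec, Matrix.dotProduct_mulVec, ← Matrix.star_mulVec]
    simp [dotProduct, Complex.conj_mul']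
  -- Cauchy–Schwarz, row by row.
  have hbound : ∀ v : n → ℂ, ∑ l, ‖(R *ᵥ v) l‖ ^ 2
      ≤ (∑ l, ∑ a, ‖R l a‖ ^ 2) * ∑ a, ‖v a‖ ^ 2 := fun v => by
    rw [Finset.sum_mul]
    refine Finset.sum_le_sum fun l _ => ?_
    refine le_trans ?_ (Finset.sum_mul_sq_le_sq_mul_sq Finset.univ (fun a => ‖R l a‖) fun a => ‖v a‖)
    refine pow_le_pow_left₀ (norm_nonneg _) ?_ 2
    refine (norm_sum_le _ _).trans_eq (Finset.sum_congr rfl fun a _ => norm_mul _ _)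
  have hcol : ∀ w : n → ℂ, Tendsto
      (fun k => (star w ⬝ᵥ (costIter p Mc k (Rᴴ * R) *ᵥ w)).re) atTop (𝓝 0) := by
    intro w
    have hre : ∀ k, (star w ⬝ᵥ (costIter p Mc k (Rᴴ * R) *ᵥ w)).re
        = ∫ ω, ∑ l, ‖(R *ᵥ linearTrajectory Mc (fun j => τ j ω) w k) l‖ ^ 2 ∂P := fun k => by
      rw [← integral_quadratic_linearTrajectory hτ hindep hp]
      simp_rw [hquad]
      rw [integral_complex_ofReal, Complex.ofReal_re]
    simp_rw [hre]
    have hlim := (hc w).const_mul (∑ l, ∑ a, ‖R l a‖ ^ 2)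
    rw [mul_zero] at hlim
    refine squeeze_zero (fun k => integral_nonneg fun ω => Finset.sum_nonneg fun l _ =>
      sq_nonneg _) (fun k => ?_) hlim
    rw [← integral_const_mul]
    exact integral_mono
      (integrable_comp_linearTrajectory hτ Mc w k fun v => ∑ l, ‖(R *ᵥ v) l‖ ^ 2)
      (integrable_comp_linearTrajectory hτ Mc w k
        fun v => (∑ l, ∑ a, ‖R l a‖ ^ 2) * ∑ a, ‖v a‖ ^ 2) fun ω => hbound _
  have htrace : ∀ X : Matrix n n ℂ, (Uᴴ * X * U).trace.re
      = ∑ j, (star (fun a => U a j) ⬝ᵥ (X *ᵥ fun a => U a j)).re := fun X => by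
    rw [Matrix.trace, Complex.re_sum]
    refine Finset.sum_congr rfl fun j _ => ?_
    rw [Matrix.mul_assoc]
    rfl
  simp_rw [htrace]
  simpa using tendsto_finsetSum Finset.univ fun j _ => hcol fun a => U a j

end IndependentChoices

/-! ### From vanishing traces to the strict bound. -/

section Rate

open scoped ComplexOrder

lemma tendsto_integral_zero_of_lintegral_tsum_lt_top {Ω : Type*} [MeasurableSpace Ω] {P : Measure Ω}
    {f : ℕ → Ω → ℝ}
    (hf : ∀ k, Integrable (f k) P) (h0 : ∀ k ω, 0 ≤ f k ω)
    (hsum : ∫⁻ ω, ∑' k, ENNReal.ofReal (f k ω) ∂P < ∞) :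
    Tendsto (fun k => ∫ ω, f k ω ∂P) atTop (𝓝 0) := by
  rw [lintegral_tsum fun k => (hf k).aemeasurable.ennreal_ofReal] at hsum
  have h := ENNReal.tendsto_atTop_zero_of_tsum_ne_top hsum.ne
  have h' := (ENNReal.tendsto_toReal ENNReal.zero_ne_top).comp h
  refine h'.congr fun k => ?_
  rw [integral_eq_lintegral_of_nonneg_ae (ae_of_all _ (h0 k)) (hf k).aestronglyMeasurable]
  rfl

/-- Each block of `q` consecutive times starting at a multiple of `q` contains exactly one multiple
of `q`. -/
lemma prod_range_mul_ite_dvd {q : ℕ} (hq : 0 < q) (a D : ℝ) (j : ℕ) :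
    ∏ k ∈ Finset.range (q * j), ((if q ∣ k then a else 1) * D) = (a * D ^ q) ^ j := by
  induction j with
  | zero => simp
  | succ j ih =>
    rw [Nat.mul_succ, Finset.prod_range_add, ih, pow_succ]
    congr 1
    rw [Finset.prod_mul_distrib, Finset.prod_const, Finset.card_range]
    congr 1
    have : ∀ i ∈ Finset.range q, (if q ∣ q * j + i then a else 1) = if i = 0 then a else 1 := by
      intro i hi
      have : q ∣ q * j + i ↔ i = 0 := by
        rw [Nat.dvd_add_right (dvd_mul_right q j)]
        exact ⟨fun h => Nat.eq_zero_of_dvd_of_lt h (Finset.mem_range.mp hi), fun h => h ▸ dvd_zero q⟩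
      simp [this]
    rw [Finset.prod_congr rfl this]
    simp [hq.ne']

/-- If the determinants of a sequence of positive semidefinite matrices lose in each period at most
the factor `a * D ^ q` while their traces tend to zero, then this factor is less than one. -/
lemma mul_pow_lt_one_of_tendsto_trace {m : Type*} [Fintype m] [DecidableEq m] [Nonempty m]
    {X : ℕ → Matrix m m ℂ} (hX : ∀ k, (X k).PosSemidef)
    (hlim : Tendsto (fun k => (X k).trace.re) atTop (𝓝 0)) {q : ℕ} (hq : 0 < q) {a D d : ℝ}
    (hd : 0 < d)
    (hdet : ∀ K, (∏ k ∈ Finset.range K, ((if q ∣ k then a else 1) * D)) * d ≤ (X K).det.re) :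
    a * D ^ q < 1 := by
  by_contra! h
  -- If the factor per period were at least one, the determinants at multiples of `q` would stay
  -- above `d`, although they are bounded by a positive power of the vanishing trace.
  have hlow : ∀ j, d ≤ (X (q * j)).trace.re ^ Fintype.card m := fun j => by
    refine le_trans ?_ ((hdet (q * j)).trans (hX _).det_le_trace_pow)
    rw [prod_range_mul_ite_dvd hq]
    exact le_mul_of_one_le_left hd.le (one_le_pow₀ h)
  have hsub : Tendsto (fun j => q * j) atTop atTop :=
    tendsto_id.const_mul_atTop' hq
  have hpow := (hlim.comp hsub).pow (Fintype.card m)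
  rw [zero_pow Fintype.card_ne_zero] at hpow
  exact absurd (ge_of_tendsto' hpow hlow) hd.not_ge

lemma det_conjTranspose_mul_self_pos {n m : Type*} [Fintype n] [Fintype m] [DecidableEq n]
    [DecidableEq m] {U : Matrix n m ℂ} {V : Matrix m n ℂ} (hVU : V * U = 1) :
    0 < (Uᴴ * (1 : Matrix n n ℂ) * U).det.re := by
  rw [Matrix.mul_one]
  have hinj : Function.Injective U.mulVec := fun x y hxy => by
    have := congrArg (V *ᵥ ·) hxy
    simpa [Matrix.mulVec_mulVec, hVU] using this
  exact (Complex.lt_def.mp (Matrix.PosDef.conjTranspose_mul_self U hinj).det_pos).1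

end Rate

/-! ### Necessary conditions for abstract random recursions. -/

section RandomRecursion

open scoped ComplexOrder

variable {ι n m Ω : Type*} [Fintype ι] [MeasurableSpace ι] [MeasurableSingletonClass ι]
  [Fintype n] [DecidableEq n] [Fintype m] [DecidableEq m] [Nonempty m] [MeasurableSpace Ω]
  {P : Measure Ω} [IsProbabilityMeasure P] {τ : ℕ → Ω → ι}

/-- A random linear recursion whose matrices act on an invariant subspace as `T` up to a rank-one
input term, which is present at the multiples of `q` only and vanishes there with probability
`∑ i ∈ Z, p i`, is mean-square stable only if that probability is less than `|det T| ^ (-2 q)`. -/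
lemma sum_mul_norm_det_pow_lt_one_of_input (hτ : ∀ k, Measurable (τ k)) (hindep : iIndepFun τ P)
    {p : ι → ℝ} (hp : ∀ k i, P.real {ω | τ k ω = i} = p i) (hsum : ∑ i, p i = 1)
    (M : ℕ → ι → Matrix n n ℝ)
    (hM : ∀ w : n → ℝ, Tendsto
      (fun k => ∫ ω, ∑ a, linearTrajectory M (fun j => τ j ω) w k a ^ 2 ∂P) atTop (𝓝 0))
    {U : Matrix n m ℂ} {V : Matrix m n ℂ} (hVU : V * U = 1) {T : Matrix m m ℂ} {b : ℕ → n → ℂ}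
    {h : ℕ → ι → m → ℂ}
    (hU : ∀ k i, (M k i).map Complex.ofReal * U = U * T + Matrix.vecMulVec (b k) (h k i))
    {q : ℕ} (hq : 0 < q) (Z : Finset ι) (hZ : ∀ k, ∀ i ∈ Z, h k i = 0)
    (hidle : ∀ k, ¬ q ∣ k → ∀ i, h k i = 0) :
    (∑ i ∈ Z, p i) * (‖T.det‖ ^ 2) ^ q < 1 := by
  have hp0 : ∀ i, 0 ≤ p i := fun i => hp 0 i ▸ measureReal_nonneg
  have hlim := tendsto_trace_costIter hτ hindep hp M hM (1 : Matrix n n ℂ) U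
  simp only [Matrix.conjTranspose_one, Matrix.one_mul] at hlim
  refine mul_pow_lt_one_of_tendsto_trace
    (fun k => (Matrix.PosSemidef.one.costIter hp0 _ k).conjTranspose_mul_mul_same U) hlim hq
    (det_conjTranspose_mul_self_pos hVU) fun K => ?_
  refine le_trans (le_of_eq ?_) (det_costIter_ge (Z := fun k => if q ∣ k then Z else Finset.univ)
    hp0 hsum hU (fun k i hi => ?_) Matrix.PosSemidef.one K)
  · congr 1
    refine Finset.prod_congr rfl fun k _ => ?_
    by_cases hk : q ∣ k <;> simp [hk, hsum]
  · by_cases hk : q ∣ k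
    · exact hZ k i (by simpa [hk] using hi)
    · exact hidle k hk i

/-- The dual of `sum_mul_norm_det_pow_lt_one_of_input`: the adjoint matrices act on an invariant
subspace as `T` up to a rank-one term. -/
lemma sum_mul_norm_det_pow_lt_one_of_output (hτ : ∀ k, Measurable (τ k)) (hindep : iIndepFun τ P)
    {p : ι → ℝ} (hp : ∀ k i, P.real {ω | τ k ω = i} = p i) (hsum : ∑ i, p i = 1)
    (M : ℕ → ι → Matrix n n ℝ)
    (hM : ∀ w : n → ℝ, Tendsto
      (fun k => ∫ ω, ∑ a, linearTrajectory M (fun j => τ j ω) w k a ^ 2 ∂P) atTop (𝓝 0))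
    {U : Matrix n m ℂ} {V : Matrix m n ℂ} (hVU : V * U = 1) {T : Matrix m m ℂ} {b : ℕ → n → ℂ}
    {h : ℕ → ι → m → ℂ}
    (hU : ∀ k i, ((M k i).map Complex.ofReal)ᴴ * U = U * T + Matrix.vecMulVec (b k) (h k i))
    {q : ℕ} (hq : 0 < q) (Z : Finset ι) (hZ : ∀ k, ∀ i ∈ Z, h k i = 0)
    (hidle : ∀ k, ¬ q ∣ k → ∀ i, h k i = 0) :
    (∑ i ∈ Z, p i) * (‖T.det‖ ^ 2) ^ q < 1 := by
  have hp0 : ∀ i, 0 ≤ p i := fun i => hp 0 i ▸ measureReal_nonneg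
  have hlim : Tendsto (fun k => (Uᴴ * covarianceIter p (fun k i => (M k i).map Complex.ofReal) 1 k
      * U).trace.re) atTop (𝓝 0) := by
    -- The roles are exchanged: `U` supplies the terminal cost `U * Uᴴ`, and the initial covariance
    -- is the identity.
    refine (tendsto_trace_costIter hτ hindep hp M hM Uᴴ (1 : Matrix n n ℂ)).congr fun k => ?_
    rw [Matrix.conjTranspose_one, Matrix.one_mul, ← trace_mul_covarianceIter,
      Matrix.conjTranspose_conjTranspose, Matrix.mul_assoc, Matrix.trace_mul_comm]
  refine mul_pow_lt_one_of_tendsto_trace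
    (fun k => (Matrix.PosSemidef.one.covarianceIter hp0 _ k).conjTranspose_mul_mul_same U) hlim hq
    (det_conjTranspose_mul_self_pos hVU) fun K => ?_
  refine le_trans (le_of_eq ?_) (det_covarianceIter_ge
    (Z := fun k => if q ∣ k then Z else Finset.univ)
    hp0 hsum hU (fun k i hi => ?_) Matrix.PosSemidef.one K)
  · congr 1
    refine Finset.prod_congr rfl fun k _ => ?_
    by_cases hk : q ∣ k <;> simp [hk, hsum]
  · by_cases hk : q ∣ k
    · exact hZ k i (by simpa [hk] using hi)
    · exact hidle k hk i

end RandomRecursion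

/-! ### The two linear recursions inside the closed loop. -/

section Loop

variable {n d N : ℕ} [NeZero N]

lemma IsPeriodicVector.switchAt_eq {s : Fin N → Fin 2} {m : ℕ} (hs : IsPeriodicVector s m)
    (k : ℕ) : switchAt s k = if (N / m) ∣ k then 1 else 0 := by
  have hdvd : (N / m) ∣ ((Fin.ofNat N k : Fin N) : ℕ) ↔ (N / m) ∣ k := by
    rw [Fin.val_ofNat, Nat.dvd_mod_iff (Nat.div_dvd_of_dvd hs.2.1)]
  rw [switchAt, hs.2.2]
  simp only [hdvd]
  split_ifs <;> simp

lemma IsPeriodicVector.div_pos {s : Fin N → Fin 2} {m : ℕ} (hs : IsPeriodicVector s m) :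
    0 < N / m :=
  Nat.div_pos (Nat.le_of_dvd (NeZero.pos N) hs.2.1) hs.1

/-- The matrices of the observer error recursion. -/
def observerMatrix (G : Plant n) (s₁ : Fin N → Fin 2) (K : ObserverController N n) (k : ℕ)
    (i : Fin 2 × Fin 2) : Matrix (Fin n) (Fin n) ℝ :=
  G.A + Matrix.vecMulVec ((((i.1 : ℕ) : ℝ) * switchAt s₁ k) • K.L k i.2) G.C

/-- The matrices of the recursion of plant and decoder when the observer error vanishes. -/
def controlMatrix (G : Plant n) (s₂ : Fin N → Fin 2) (K : ObserverController N n)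
    (D : Decoder N d) (k : ℕ) (i : Fin 2 × Fin 2) : Matrix (Fin n ⊕ Fin d) (Fin n ⊕ Fin d) ℝ :=
  Matrix.fromBlocks G.A (Matrix.vecMulVec G.B (D.CD k)) 0
      (D.AD k + Matrix.vecMulVec (D.BD k) (D.CD k))
    + Matrix.vecMulVec (Sum.elim G.B (D.BD k))
      ((((i.2 : ℕ) : ℝ) * switchAt s₂ k) • Sum.elim (K.F k i.1) (-D.CD k))

variable (G : Plant n) (s₁ s₂ : Fin N → Fin 2) (K : ObserverController N n) (D : Decoder N d)

/-- The applied input enters plant and observer identically and cancels, whatever the decoder does.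
-/
lemma observerError_eq_linearTrajectory (σ : ℕ → Fin 2 × Fin 2) (z₀ : LoopState n d) (k : ℕ) :
    (loopTrajectory G s₁ s₂ K D (fun j => (σ j).1) (fun j => (σ j).2) z₀ k).ξ
        - (loopTrajectory G s₁ s₂ K D (fun j => (σ j).1) (fun j => (σ j).2) z₀ k).x
      = linearTrajectory (observerMatrix G s₁ K) σ (z₀.ξ - z₀.x) k := by
  induction k with
  | zero => rfl
  | succ k ih =>
    rw [linearTrajectory, ← ih]
    simp only [loopTrajectory, loopStep, observerMatrix, Matrix.add_mulVec, Matrix.vecMulVec_mulVec,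
      Matrix.mulVec_sub]
    ext a
    simp
    ring

/-- With `ξ = x` at the start the innovation stays zero, so the input is the decoder's candidate
plus `t₂ (F x - CD η)`, entering through the single column `(B, BD)`. -/
lemma plantDecoder_eq_linearTrajectory (σ : ℕ → Fin 2 × Fin 2) (z₀ : LoopState n d)
    (hz₀ : z₀.ξ = z₀.x) (k : ℕ) :
    Sum.elim (loopTrajectory G s₁ s₂ K D (fun j => (σ j).1) (fun j => (σ j).2) z₀ k).x
        (loopTrajectory G s₁ s₂ K D (fun j => (σ j).1) (fun j => (σ j).2) z₀ k).η
      = linearTrajectory (controlMatrix G s₂ K D) σ (Sum.elim z₀.x z₀.η) k := by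
  have hξ : ∀ k, (loopTrajectory G s₁ s₂ K D (fun j => (σ j).1) (fun j => (σ j).2) z₀ k).ξ
      = (loopTrajectory G s₁ s₂ K D (fun j => (σ j).1) (fun j => (σ j).2) z₀ k).x := by
    intro k
    induction k with
    | zero => exact hz₀
    | succ k ih => simp [loopTrajectory, loopStep, ih]
  induction k with
  | zero => rfl
  | succ k ih =>
    rw [linearTrajectory, ← ih]
    simp only [loopTrajectory, loopStep, controlMatrix, Matrix.add_mulVec, Matrix.vecMulVec_mulVec,
      Matrix.fromBlocks_mulVec, hξ, Decoder.next, Decoder.output, Decoder.candidate,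
      smul_dotProduct, Sum.elim_comp_inl, Sum.elim_comp_inr, Matrix.zero_mulVec, zero_add]
    rw [sumElim_dotProduct_sumElim, neg_dotProduct]
    ext a
    rcases a with a | a
    · simp
      ring
    · simp
      ring

end Loop

section Losses

variable {Ω : Type*} [MeasurableSpace Ω] {P : Measure Ω} [IsProbabilityMeasure P]

lemma sum_measureReal_fiber {ι : Type*} [MeasurableSpace ι] [MeasurableSingletonClass ι]
    {τ : Ω → ι} (hτ : Measurable τ) (Z : Finset ι) :
    ∑ i ∈ Z, P.real {ω | τ ω = i} = P.real {ω | τ ω ∈ Z} := by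
  have : {ω | τ ω ∈ Z} = ⋃ i ∈ Z, {ω | τ ω = i} := by
    ext ω
    simp
  rw [this, measureReal_biUnion_finset]
  · intro i _ j _ hij
    exact Set.disjoint_left.mpr fun ω hi hj => hij (hi.symm.trans hj)
  · exact fun i _ => hτ (measurableSet_singleton i)

end Losses

/-! ### The unstable part of the plant. -/

namespace Plant

variable {n : ℕ} (G : Plant n)

open Classical in
lemma unstableProd_eq_norm_pow (q : ℕ) :
    G.unstableProd q = ‖(G.eigenvalues.filter fun l => 1 < ‖l‖).prod‖ ^ q := by
  rw [unstableProd, Multiset.prod_map_pow]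
  exact congrArg (· ^ q) (map_multiset_prod (normHom : ℂ →*₀ ℝ) _).symm

open Classical in
lemma Unstable.one_lt_unstableProd {G : Plant n} (h : G.Unstable) : 1 < G.unstableProd 1 := by
  obtain ⟨l, hl, hl1⟩ := h
  have hmem : l ∈ G.eigenvalues.filter fun l => 1 < ‖l‖ := Multiset.mem_filter.mpr ⟨hl, hl1⟩
  obtain ⟨t, ht⟩ := Multiset.exists_cons_of_mem hmem
  have ht1 : ∀ x ∈ t.map fun l : ℂ => ‖l‖ ^ 1, 1 ≤ x := by
    intro x hx
    obtain ⟨y, hy, rfl⟩ := Multiset.mem_map.mp hx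
    have : y ∈ G.eigenvalues.filter fun l => 1 < ‖l‖ := ht ▸ Multiset.mem_cons_of_mem hy
    rw [pow_one]
    exact (Multiset.mem_filter.mp this).2.le
  rw [unstableProd, ht, Multiset.map_cons, Multiset.prod_cons, pow_one]
  exact one_lt_mul_of_lt_of_le hl1 (Multiset.one_le_prod ht1)

lemma Unstable.unstableProd_pos {G : Plant n} (h : G.Unstable) (q : ℕ) :
    0 < G.unstableProd q := by
  have h1 := h.one_lt_unstableProd
  rw [unstableProd_eq_norm_pow, pow_one] at h1
  rw [unstableProd_eq_norm_pow]
  exact pow_pos (one_pos.trans h1) q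

/-- The unstable part of a matrix with the same characteristic polynomial as `A`. -/
lemma Unstable.exists_invariant {G : Plant n} (h : G.Unstable) {A : Matrix (Fin n) (Fin n) ℂ}
    (hA : A.charpoly = (G.A.map (algebraMap ℝ ℂ)).charpoly) :
    ∃ (m : ℕ) (_ : Nonempty (Fin m)) (U : Matrix (Fin n) (Fin m) ℂ)
      (V : Matrix (Fin m) (Fin n) ℂ) (T : Matrix (Fin m) (Fin m) ℂ),
      V * U = 1 ∧ A * U = U * T ∧ ∀ q, G.unstableProd (2 * q) = (‖T.det‖ ^ 2) ^ q := by
  classical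
  obtain ⟨m, U, V, T, hVU, hAU, hT⟩ := A.exists_invariant_det fun l => 1 < ‖l‖
  have hprod : ∀ q, G.unstableProd q = ‖T.det‖ ^ q := fun q => by
    rw [unstableProd_eq_norm_pow, hT, hA]
    rfl
  refine ⟨m, ?_, U, V, T, hVU, hAU, fun q => by rw [hprod, pow_mul]⟩
  -- On a zero-dimensional space `det T = 1`, contradicting an eigenvalue product greater than one.
  by_contra hm
  rw [not_nonempty_iff] at hm
  have h1 := h.one_lt_unstableProd
  rw [hprod, Matrix.det_isEmpty] at h1
  simp at h1

end Plant

/-! ### The bounds for the two channels. -/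

section Necessity

variable {n d N : ℕ} [NeZero N] {Ω : Type*} [MeasurableSpace Ω] {P : Measure Ω} {G : Plant n}
  {s₁ s₂ : Fin N → Fin 2} {θ₁ θ₂ : ℕ → Ω → Fin 2} {α₁ α₂ : ℝ} {K : ObserverController N n} {D : Decoder N d}

/-- The factor 2 accommodates `|ξ - x|² ≤ 2 (|x|² + |ξ|²)`. -/
lemma LoopStochasticallyStable.tendsto_integral
    (hstab : LoopStochasticallyStable P G s₁ s₂ K D θ₁ θ₂) (z₀ : LoopState n d)
    {f : ℕ → Ω → ℝ} (hf : ∀ k, Integrable (f k) P) (h0 : ∀ k ω, 0 ≤ f k ω)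
    (hle : ∀ k ω, f k ω ≤ 2 *
      (loopTrajectory G s₁ s₂ K D (fun j => θ₁ j ω) (fun j => θ₂ j ω) z₀ k).sqNorm) :
    Tendsto (fun k => ∫ ω, f k ω ∂P) atTop (𝓝 0) := by
  refine tendsto_integral_zero_of_lintegral_tsum_lt_top hf h0 (lt_of_le_of_lt ?_
    (ENNReal.mul_lt_top (ENNReal.ofReal_lt_top (r := 2)) (hstab z₀)))
  rw [← lintegral_const_mul' _ _ ENNReal.ofReal_ne_top]
  refine lintegral_mono fun ω => ?_
  rw [← ENNReal.tsum_mul_left]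
  refine ENNReal.tsum_le_tsum fun k => ?_
  rw [← ENNReal.ofReal_mul zero_le_two]
  exact ENNReal.ofReal_le_ofReal (hle k ω)

lemma IsLossProcess.measurable_pair (hθ : IsLossProcess P θ₁ θ₂ α₁ α₂) (k : ℕ) :
    Measurable fun ω => (θ₁ k ω, θ₂ k ω) :=
  (hθ.measurable₁ k).prodMk (hθ.measurable₂ k)

lemma IsLossProcess.measureReal_pair (hθ : IsLossProcess P θ₁ θ₂ α₁ α₂) (k : ℕ)
    (i : Fin 2 × Fin 2) : P.real {ω | (θ₁ k ω, θ₂ k ω) = i} = P.real {ω | (θ₁ 0 ω, θ₂ 0 ω) = i} :=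
  congrArg ENNReal.toReal ((hθ.identDistrib k).measure_mem_eq (measurableSet_singleton i))

variable [IsProbabilityMeasure P]

lemma IsLossProcess.sum_measureReal_pair (hθ : IsLossProcess P θ₁ θ₂ α₁ α₂) :
    ∑ i, P.real {ω | (θ₁ 0 ω, θ₂ 0 ω) = i} = 1 := by
  rw [sum_measureReal_fiber (hθ.measurable_pair 0)]
  simp

/-- Mean-square stability of the observer error bounds the loss probability of the measurement
channel. -/
lemma IsLossProcess.measurement_loss_lt (hθ : IsLossProcess P θ₁ θ₂ α₁ α₂) (hG : G.Unstable)
    {N₁ : ℕ} (hs₁ : IsPeriodicVector s₁ N₁)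
    (hstab : LoopStochasticallyStable P G s₁ s₂ K D θ₁ θ₂) :
    α₁ < 1 / G.unstableProd (2 * (N / N₁)) := by
  classical
  obtain ⟨m, _, U, V, T, hVU, hAU, hT⟩ := hG.exists_invariant
    (Matrix.charpoly_transpose (G.A.map (algebraMap ℝ ℂ)))
  rw [lt_div_iff₀ (hG.unstableProd_pos _), hT]
  have hα : ∑ i ∈ Finset.univ.filter (fun i : Fin 2 × Fin 2 => i.1 = 0),
      P.real {ω | (θ₁ 0 ω, θ₂ 0 ω) = i} = α₁ := by
    rw [sum_measureReal_fiber (hθ.measurable_pair 0), ← hθ.loss₁ 0]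
    simp
  rw [← hα]
  refine sum_mul_norm_det_pow_lt_one_of_output hθ.measurable_pair hθ.indep hθ.measureReal_pair
    hθ.sum_measureReal_pair (observerMatrix G s₁ K) (fun w => ?_) hVU (b := fun _ a => (G.C a : ℂ))
    (h := fun k i => (fun a => ((((i.1 : ℕ) : ℝ) * switchAt s₁ k * K.L k i.2 a : ℝ) : ℂ)) ᵥ* U)
    (fun k i => ?_) hs₁.div_pos _ (fun k i hi => ?_) (fun k hk i => ?_)
  -- Starting the plant at zero and the observer at `w` realizes an arbitrary initial error `w`.
  · refine hstab.tendsto_integral ⟨0, w, 0⟩ (fun k => integrable_comp_linearTrajectory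
      hθ.measurable_pair _ w k fun v => ∑ a, v a ^ 2)
      (fun k ω => Finset.sum_nonneg fun a _ => sq_nonneg _) fun k ω => ?_
    have herr := observerError_eq_linearTrajectory G s₁ s₂ K D (fun j => (θ₁ j ω, θ₂ j ω))
      ⟨0, w, 0⟩ k
    rw [sub_zero] at herr
    rw [← herr, LoopState.sqNorm]
    set z := loopTrajectory G s₁ s₂ K D (fun j => θ₁ j ω) (fun j => θ₂ j ω) ⟨0, w, 0⟩ k
    have hη : 0 ≤ z.η ⬝ᵥ z.η := Finset.sum_nonneg fun a _ => mul_self_nonneg _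
    have hxξ : ∑ a, (z.ξ - z.x) a ^ 2 ≤ 2 * (z.x ⬝ᵥ z.x + z.ξ ⬝ᵥ z.ξ) := by
      simp only [dotProduct, ← Finset.sum_add_distrib, Finset.mul_sum]
      exact Finset.sum_le_sum fun a _ => by
        rw [Pi.sub_apply]
        nlinarith [sq_nonneg (z.ξ a + z.x a)]
    linarith
  -- In the adjoint the fixed column is `C`, and the random gain moves into the row; hence the
  -- invariant subspace of the transpose of `A`.
  · have : ((observerMatrix G s₁ K k i).map Complex.ofReal)ᴴ
        = (G.A.map (algebraMap ℝ ℂ))ᵀ + Matrix.vecMulVec (fun a => (G.C a : ℂ))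
          (fun a => ((((i.1 : ℕ) : ℝ) * switchAt s₁ k * K.L k i.2 a : ℝ) : ℂ)) := by
      ext a b
      simp [observerMatrix, Matrix.vecMulVec_apply]
      ring
    rw [this, Matrix.add_mul, hAU, Matrix.vecMulVec_mul]
  · have : i.1 = 0 := by simpa using hi
    ext a
    simp [this, Matrix.vecMul, dotProduct]
  · ext a
    simp [hs₁.switchAt_eq, hk, Matrix.vecMul, dotProduct]

/-- Mean-square stability without observer error bounds the loss probability of the control
channel. -/
lemma IsLossProcess.control_loss_lt (hθ : IsLossProcess P θ₁ θ₂ α₁ α₂) (hG : G.Unstable)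
    {N₂ : ℕ} (hs₂ : IsPeriodicVector s₂ N₂)
    (hstab : LoopStochasticallyStable P G s₁ s₂ K D θ₁ θ₂) :
    α₂ < 1 / G.unstableProd (2 * (N / N₂)) := by
  classical
  obtain ⟨m, _, U, V, T, hVU, hAU, hT⟩ := hG.exists_invariant rfl
  rw [lt_div_iff₀ (hG.unstableProd_pos _), hT]
  have hα : ∑ i ∈ Finset.univ.filter (fun i : Fin 2 × Fin 2 => i.2 = 0),
      P.real {ω | (θ₁ 0 ω, θ₂ 0 ω) = i} = α₂ := by
    rw [sum_measureReal_fiber (hθ.measurable_pair 0), ← hθ.loss₂ 0]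
    simp
  rw [← hα]
  -- The unstable subspace of `A`, extended by zero in the decoder coordinates, is invariant under
  -- the block triangular part.
  have hVU' : Matrix.fromCols V (0 : Matrix (Fin m) (Fin d) ℂ)
      * Matrix.fromRows U (0 : Matrix (Fin d) (Fin m) ℂ) = 1 := by
    rw [Matrix.fromCols_mul_fromRows, hVU, Matrix.zero_mul, add_zero]
  refine sum_mul_norm_det_pow_lt_one_of_input hθ.measurable_pair hθ.indep hθ.measureReal_pair
    hθ.sum_measureReal_pair (controlMatrix G s₂ K D) (fun w => ?_) hVU'
    (b := fun k a => ((Sum.elim G.B (D.BD k) a : ℝ) : ℂ))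
    (h := fun k i => (fun a => ((((i.2 : ℕ) : ℝ) * switchAt s₂ k
      * Sum.elim (K.F k i.1) (-D.CD k) a : ℝ) : ℂ)) ᵥ* Matrix.fromRows U 0)
    (fun k i => ?_) hs₂.div_pos _ (fun k i hi => ?_) (fun k hk i => ?_)
  -- The observer starts at the true plant state, which leaves plant and decoder states arbitrary.
  · set z₀ : LoopState n d := ⟨w ∘ Sum.inl, w ∘ Sum.inl, w ∘ Sum.inr⟩ with hz₀
    refine hstab.tendsto_integral z₀ (fun k => integrable_comp_linearTrajectory
      hθ.measurable_pair _ w k fun v => ∑ a, v a ^ 2)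
      (fun k ω => Finset.sum_nonneg fun a _ => sq_nonneg _) fun k ω => ?_
    have htraj := plantDecoder_eq_linearTrajectory G s₁ s₂ K D (fun j => (θ₁ j ω, θ₂ j ω))
      z₀ rfl k
    rw [hz₀, Sum.elim_comp_inl_inr, ← hz₀] at htraj
    rw [← htraj, LoopState.sqNorm]
    set z := loopTrajectory G s₁ s₂ K D (fun j => θ₁ j ω) (fun j => θ₂ j ω) z₀ k
    have hη : 0 ≤ z.η ⬝ᵥ z.η := Finset.sum_nonneg fun a _ => mul_self_nonneg _
    have hξ : 0 ≤ z.ξ ⬝ᵥ z.ξ := Finset.sum_nonneg fun a _ => mul_self_nonneg _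
    have hx : 0 ≤ z.x ⬝ᵥ z.x := Finset.sum_nonneg fun a _ => mul_self_nonneg _
    have : ∑ a, Sum.elim z.x z.η a ^ 2 = z.x ⬝ᵥ z.x + z.η ⬝ᵥ z.η := by
      simp [dotProduct, pow_two]
    linarith
  · have : (controlMatrix G s₂ K D k i).map Complex.ofReal
        = Matrix.fromBlocks (G.A.map (algebraMap ℝ ℂ))
            ((Matrix.vecMulVec G.B (D.CD k)).map Complex.ofReal) 0
            ((D.AD k + Matrix.vecMulVec (D.BD k) (D.CD k)).map Complex.ofReal)
          + Matrix.vecMulVec (fun a => ((Sum.elim G.B (D.BD k) a : ℝ) : ℂ))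
          (fun a => ((((i.2 : ℕ) : ℝ) * switchAt s₂ k
            * Sum.elim (K.F k i.1) (-D.CD k) a : ℝ) : ℂ)) := by
      ext a b
      rcases a with a | a <;> rcases b with b | b <;>
        simp [controlMatrix, Matrix.vecMulVec_apply] <;> ring
    rw [this, Matrix.add_mul, Matrix.vecMulVec_mul, Matrix.fromBlocks_mul_fromRows,
      Matrix.fromRows_mul, hAU]
    simp
  · have : i.2 = 0 := by simpa using hi
    ext a
    simp [this, Matrix.vecMul, dotProduct]
  · ext a
    simp [hs₂.switchAt_eq, hk, Matrix.vecMul, dotProduct]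

end Necessity

end

theorem proposition4 {n d N : ℕ} [NeZero N]
    {Ω : Type*} [MeasurableSpace Ω] (P : Measure Ω) [IsProbabilityMeasure P]
    (G : Plant n) (hctrb : G.Controllable) (hobs : G.Observable) (hunst : G.Unstable)
    (s₁ s₂ : Fin N → Fin 2) (N₁ N₂ : ℕ)
    (hs₁ : IsPeriodicVector s₁ N₁) (hs₂ : IsPeriodicVector s₂ N₂)
    (θ₁ θ₂ : ℕ → Ω → Fin 2) (α₁ α₂ : ℝ) (hθ : IsLossProcess P θ₁ θ₂ α₁ α₂)
    (K : ObserverController N n) (D : Decoder N d) (hD : D.InternallyStable)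
    (hstab : LoopStochasticallyStable P G s₁ s₂ K D θ₁ θ₂) :
    α₁ < 1 / G.unstableProd (2 * (N / N₁)) ∧ α₂ < 1 / G.unstableProd (2 * (N / N₂)) :=
  ⟨hθ.measurement_loss_lt hunst hs₁ hstab, hθ.control_loss_lt hunst hs₂ hstab⟩
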